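/- Let $K$ be a field and let $V_1,\dots,V_r$ be pairwise independent valuation rings of $K$; that is, for all $i\neq j$ the only valuation ring of $K$ containing both $V_i$ and $V_j$ is $K$ itself. Suppose that for each $i$ the maximal ideal of $V_i$ is principal or the residue field of $V_i$ is not algebraically closed. Put $D=V_1\cap\cdots\cap V_r$ (with $D=K$ if $r=0$). For a subset $E\subseteq K$ let $$\operatorname{Int}^{\mathrm R}(E,D)=\{\varphi\in K(x)\mid \varphi \text{ has no pole in } E \text{ and } \varphi(a)\in D \text{ for all } a\in E\}$$ be the ring of integer-valued rational functions on $E$ over $D$. Then for every subset $E\subseteq K$ the ring $\operatorname{Int}^{\mathrm R}(E,D)$ is a Prüfer domain (an integral domain in which every nonzero finitely generated ideal is invertible) and its Picard group is a torsion group. -/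

import Mathlib

open scoped nonZeroDivisors

/-- A Prüfer domain: an integral domain in which every nonzero finitely generated ideal is
invertible (as a fractional ideal of the field of fractions). -/
class IsPruferDomain (R : Type*) [CommRing R] : Prop extends IsDomain R where
  isUnit_of_fg : ∀ I : Ideal R, I.FG → I ≠ ⊥ → IsUnit (I : FractionalIdeal R⁰ (FractionRing R))

/-- Two valuation rings of a field `K` are independent if `K` is the only valuation ring of `K`
containing both of them. (Any ring between a valuation ring of `K` and `K` is a valuation ring.) -/
def ValuationSubring.Independent {K : Type*} [Field K] (V W : ValuationSubring K) : Prop :=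
  ∀ U : ValuationSubring K, V ≤ U → W ≤ U → U = ⊤

/-- The ring of integer-valued rational functions on `E` over `D`: the rational functions over `K`
that have no pole in `E` and whose value at each point of `E` lies in `D`. -/
noncomputable def intValuedRatFunc {K : Type*} [Field K] (E : Set K) (D : Subring K) :
    Subring (RatFunc K) where
  carrier := {φ | ∀ a ∈ E, φ.denom.eval a ≠ 0 ∧ φ.eval (RingHom.id K) a ∈ D}
  zero_mem' := fun a _ => by
    refine ⟨by simp, ?_⟩
    rw [RatFunc.eval_zero]
    exact D.zero_mem
  one_mem' := fun a _ => by
    refine ⟨by simp, ?_⟩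
    rw [RatFunc.eval_one]
    exact D.one_mem
  add_mem' := fun {φ ψ} hφ hψ a ha => by
    obtain ⟨h1, h2⟩ := hφ a ha
    obtain ⟨h3, h4⟩ := hψ a ha
    constructor
    · intro h
      have := Polynomial.eval_eq_zero_of_dvd_of_eval_eq_zero (RatFunc.denom_add_dvd φ ψ) h
      rw [Polynomial.eval_mul] at this
      exact (mul_ne_zero h1 h3) this
    · rw [RatFunc.eval_add _ _ h1 h3]
      exact D.add_mem h2 h4
  mul_mem' := fun {φ ψ} hφ hψ a ha => by
    obtain ⟨h1, h2⟩ := hφ a ha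
    obtain ⟨h3, h4⟩ := hψ a ha
    constructor
    · intro h
      have := Polynomial.eval_eq_zero_of_dvd_of_eval_eq_zero (RatFunc.denom_mul_dvd φ ψ) h
      rw [Polynomial.eval_mul] at this
      exact (mul_ne_zero h1 h3) this
    · rw [RatFunc.eval_mul _ _ h1 h3]
      exact D.mul_mem h2 h4
  neg_mem' := fun {φ} hφ a ha => by
    obtain ⟨h1, h2⟩ := hφ a ha
    have hc : (RatFunc.C (-1 : K)).denom.eval₂ (RingHom.id K) a ≠ 0 := by
      rw [RatFunc.denom_C]
      simp
    have e : -φ = RatFunc.C (-1 : K) * φ := by simp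
    rw [e]
    constructor
    · intro h
      have := Polynomial.eval_eq_zero_of_dvd_of_eval_eq_zero
        (RatFunc.denom_mul_dvd (RatFunc.C (-1 : K)) φ) h
      rw [Polynomial.eval_mul] at this
      exact (mul_ne_zero hc h1) this
    · rw [RatFunc.eval_mul _ _ hc h1, RatFunc.eval_C]
      exact D.mul_mem (D.neg_mem D.one_mem) h2

/-! ### From pairs of generators to Prüfer domains with torsion Picard group -/

section TwoGenerated

/-! It suffices that every ideal `(a, b)` with `a, b ≠ 0` has a principal positive power. Such an
ideal is invertible, invertibility passes from two generators to finitely many, and `(I + J)^n = I^n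
+ J^n` for invertible `I + J` then makes a power of every finitely generated ideal principal.

Outside trivial cases `A = Int^R(E, D)` is an intersection of valuation rings `W` of `K(x)`, one for
each `V i` and each point of `E`. With `z = b / a`, a generator of `(a, b)^n` should have value
`max(1, w(z))^n` relative to `a^n` at every `W`. If the residue field has a monic polynomial `f`
without roots, a lift of a power of `f`, evaluated at `z`, has such a value. If `t` generates the
maximal ideal, `1 + t z^m` has value `1` when `z ∈ W` and `w(t) w(z)^m` otherwise. The unwanted
factor `w(t)` disappears in the quotient `P / Q` of such polynomials of degrees `2n` and `n`.

The coefficients may be taken in `K` and perturbed slightly, so approximation yields one polynomial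
serving all `V i`. Since `W` has the residue field of `V i`, and the same generator of the maximal
ideal if there is one, that polynomial serves all points of `E` too. Independence enters only as
incomparability of the nontrivial `V i`. -/

theorem isUnit_add_add_of_isUnit_add {M : Type*} [CommSemiring M] (hM : ∀ x : M, x + x = x)
    {a b c : M} (hab : IsUnit (a + b)) (hbc : IsUnit (b + c)) (hca : IsUnit (c + a)) :
    IsUnit (a + b + c) := by
  -- The two sides contain `abc` three times and twice, which agree when addition is idempotent, as
  -- for fractional ideals. A factor of a unit is a unit.
  have key : (a + b + c) * (a * b + b * c + c * a) = (a + b) * (b + c) * (c + a) := by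
    calc _ = (a ^ 2 * b + a ^ 2 * c + b ^ 2 * a + b ^ 2 * c + c ^ 2 * a + c ^ 2 * b)
          + ((a * b * c + a * b * c) + a * b * c) := by ring
      _ = (a ^ 2 * b + a ^ 2 * c + b ^ 2 * a + b ^ 2 * c + c ^ 2 * a + c ^ 2 * b)
          + (a * b * c + a * b * c) := by rw [hM (a * b * c), hM (a * b * c)]
      _ = _ := by ring
  exact isUnit_of_mul_isUnit_left (key ▸ (hab.mul hbc).mul hca)

variable {A : Type*} [CommRing A]

/-- In each product `I^k J^(2n-k)` one exponent is at least `n`; that `n`-th power is split off and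
the remaining `n` factors lie in `I ⊔ J`. -/
theorem Ideal.sup_pow_add_self (I J : Ideal A) (n : ℕ) :
    (I ⊔ J) ^ (n + n) = (I ⊔ J) ^ n * (I ^ n ⊔ J ^ n) := by
  apply le_antisymm
  · rw [← Ideal.add_eq_sup (I := I), add_pow, Ideal.sum_eq_sup, Finset.sup_le_iff]
    intro k hk
    have hk' : k ≤ n + n := Nat.lt_succ_iff.1 (Finset.mem_range.1 hk)
    refine Ideal.mul_le_left.trans ?_
    rcases le_total n k with h | h
    · obtain ⟨d, rfl⟩ := Nat.exists_eq_add_of_le h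
      obtain ⟨e, rfl⟩ := Nat.exists_eq_add_of_le (Nat.add_le_add_iff_left.1 hk')
      calc I ^ (d + e + d) * J ^ (d + e + (d + e) - (d + e + d)) = (I ^ d * J ^ e) * I ^ (d + e) := by
            rw [show d + e + (d + e) - (d + e + d) = e by lia]; ring
        _ ≤ ((I + J) ^ d * (I + J) ^ e) * (I ^ (d + e) ⊔ J ^ (d + e)) := by
            gcongr
            · exact le_sup_left
            · exact le_sup_right
            · exact le_sup_left
        _ = _ := by rw [← pow_add]
    · obtain ⟨d, rfl⟩ := Nat.exists_eq_add_of_le h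
      calc I ^ k * J ^ (k + d + (k + d) - k) = (I ^ k * J ^ d) * J ^ (k + d) := by
            rw [show k + d + (k + d) - k = d + (k + d) by lia]; ring
        _ ≤ ((I + J) ^ k * (I + J) ^ d) * (I ^ (k + d) ⊔ J ^ (k + d)) := by
            gcongr
            · exact le_sup_left
            · exact le_sup_right
            · exact le_sup_right
        _ = _ := by rw [← pow_add]
  · rw [pow_add]
    refine Ideal.mul_mono_right (sup_le ?_ ?_)
    · exact Ideal.pow_right_mono le_sup_left n
    · exact Ideal.pow_right_mono le_sup_right n

variable [IsDomain A]

theorem Ideal.isUnit_coe_of_pow_eq_span {I : Ideal A} {n : ℕ} (hn : n ≠ 0) {g : A} (hg : g ≠ 0)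
    (h : I ^ n = Ideal.span {g}) : IsUnit (I : FractionalIdeal A⁰ (FractionRing A)) := by
  rw [← isUnit_pow_iff hn, ← FractionalIdeal.coeIdeal_pow, h,
    FractionalIdeal.coeIdeal_span_singleton]
  exact ⟨toPrincipalIdeal A (FractionRing A) (Units.mk0 (algebraMap A _ g) (by simpa using hg)),
    coe_toPrincipalIdeal _⟩

theorem Ideal.sup_pow_of_isUnit {I J : Ideal A}
    (h : IsUnit ((I ⊔ J : Ideal A) : FractionalIdeal A⁰ (FractionRing A))) (n : ℕ) :
    (I ⊔ J) ^ n = I ^ n ⊔ J ^ n := by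
  have := I.sup_pow_add_self J n
  rw [pow_add] at this
  have h2 := congrArg (fun L : Ideal A => (L : FractionalIdeal A⁰ (FractionRing A))) this
  simp only [FractionalIdeal.coeIdeal_mul, FractionalIdeal.coeIdeal_pow] at h2
  have h3 := (h.pow n).mul_left_cancel h2
  rw [← FractionalIdeal.coeIdeal_pow] at h3
  exact FractionalIdeal.coeIdeal_injective h3

/-- Every ideal of `A` generated by two nonzero elements has a principal positive power. -/
def HasPrincipalPairPowers (A : Type*) [CommRing A] : Prop :=
  ∀ a b : A, a ≠ 0 → b ≠ 0 → ∃ n : ℕ, n ≠ 0 ∧ ∃ g : A, Ideal.span {a, b} ^ n = Ideal.span {g}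

theorem Ideal.span_finset_insert {A : Type*} [CommRing A] [DecidableEq A] (a : A) (s : Finset A) :
    Ideal.span ((insert a s : Finset A) : Set A) = Ideal.span {a} ⊔ Ideal.span (s : Set A) := by
  rw [Finset.coe_insert, Ideal.span_insert]

theorem HasPrincipalPairPowers.isUnit_pair (h : HasPrincipalPairPowers A) {a b : A} (ha : a ≠ 0)
    (hb : b ≠ 0) : IsUnit (Ideal.span {a, b} : FractionalIdeal A⁰ (FractionRing A)) := by
  obtain ⟨n, hn, g, hg⟩ := h a b ha hb
  refine Ideal.isUnit_coe_of_pow_eq_span hn ?_ hg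
  rintro rfl
  rw [Ideal.span_singleton_zero] at hg
  have h0 : Ideal.span {a, b} = ⊥ := eq_zero_of_pow_eq_zero (by simpa using hg) 
  exact ha (by simpa [h0] using Ideal.subset_span (s := {a, b}) (Set.mem_insert a {b}))

/-- Induction on the number of generators: for `(a) + (c) + (b)`, with `b` the set of remaining
generators, each sum of two of the three summands needs fewer generators, so
`isUnit_add_add_of_isUnit_add` applies. -/
theorem HasPrincipalPairPowers.isUnit_finset (h : HasPrincipalPairPowers A) (n : ℕ) :
    ∀ s : Finset A, s.card = n → s.Nonempty → (∀ x ∈ s, x ≠ 0) →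
      IsUnit (Ideal.span (s : Set A) : FractionalIdeal A⁰ (FractionRing A)) := by
  classical
  induction n using Nat.strong_induction_on with
  | _ n ih =>
    rintro s hs ⟨a, ha⟩ h0
    obtain ⟨t, hat, rfl⟩ : ∃ t, a ∉ t ∧ insert a t = s :=
      ⟨s.erase a, by simp, Finset.insert_erase ha⟩
    rcases t.eq_empty_or_nonempty with rfl | ⟨c, hc⟩
    · simpa using h.isUnit_pair (h0 a ha) (h0 a ha)
    obtain ⟨b, hcb, rfl⟩ : ∃ b, c ∉ b ∧ insert c b = t :=
      ⟨t.erase c, by simp, Finset.insert_erase hc⟩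
    have ha0 := h0 a ha
    have hc0 := h0 c (Finset.mem_insert_of_mem hc)
    rcases b.eq_empty_or_nonempty with rfl | hb
    · simpa using h.isUnit_pair ha0 hc0
    rw [Finset.card_insert_of_notMem hat] at hs
    have hab : a ∉ b := fun hh => hat (Finset.mem_insert_of_mem hh)
    have hb0 : ∀ x ∈ b, x ≠ 0 := fun x hx => h0 x (by simp [hx])
    have h1 := ih _ (by rw [← hs, Finset.card_insert_of_notMem hab,
      Finset.card_insert_of_notMem hcb]; lia) (insert a b) rfl (Finset.insert_nonempty _ _)
      (by simpa [ha0] using hb0)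
    have h2 := ih _ (by lia) (insert c b) rfl (Finset.insert_nonempty _ _)
      (by simpa [hc0] using hb0)
    have h3 := h.isUnit_pair hc0 ha0
    rw [Ideal.span_finset_insert, FractionalIdeal.coeIdeal_sup] at h1 h2 ⊢
    rw [Ideal.span_finset_insert, FractionalIdeal.coeIdeal_sup]
    rw [Ideal.span_insert, FractionalIdeal.coeIdeal_sup] at h3
    have := isUnit_add_add_of_isUnit_add (fun x => sup_idem (a := x)) h1 (by rwa [add_comm]) h3
    rwa [add_assoc, add_comm (Ideal.span (b : Set A) : FractionalIdeal A⁰ (FractionRing A))] at this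

theorem HasPrincipalPairPowers.isPruferDomain (h : HasPrincipalPairPowers A) :
    IsPruferDomain A where
  isUnit_of_fg I hI hI0 := by
    classical
    obtain ⟨s, rfl⟩ := hI
    have hs : Ideal.span (s : Set A) = Ideal.span ((s.erase 0 : Finset A) : Set A) := by
      rw [Finset.coe_erase, Ideal.span_sdiff_singleton_zero]
    have hne : (s.erase 0).Nonempty := by
      by_contra hne
      rw [Finset.not_nonempty_iff_eq_empty] at hne
      exact hI0 (by rw [hs, hne]; simp)
    rw [hs]
    exact h.isUnit_finset _ _ rfl hne (fun x hx => (Finset.mem_erase.1 hx).1)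

theorem HasPrincipalPairPowers.exists_pow_eq_span (h : HasPrincipalPairPowers A) (s : Finset A) :
    ∃ n : ℕ, n ≠ 0 ∧ ∃ g : A, Ideal.span (s : Set A) ^ n = Ideal.span {g} := by
  classical
  have hP := h.isPruferDomain
  induction s using Finset.induction_on with
  | empty => exact ⟨1, one_ne_zero, 0, by simp⟩
  | insert a s has ih =>
    obtain ⟨n, hn, g, hg⟩ := ih
    rw [Ideal.span_finset_insert]
    by_cases ha : a = 0
    · exact ⟨n, hn, g, by simpa [ha] using hg⟩
    have hu : IsUnit ((Ideal.span {a} ⊔ Ideal.span (s : Set A) : Ideal A) :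
        FractionalIdeal A⁰ (FractionRing A)) := by
      refine hP.isUnit_of_fg _ ?_ ?_
      · exact (Submodule.fg_span_singleton a).sup ⟨s, rfl⟩
      · intro h0
        have : Ideal.span {a} ≤ ⊥ := h0 ▸ le_sup_left
        simp [ha] at this
    -- The `n`-th power becomes `(a^n) + (g)`, which is again generated by a pair.
    have h1 := Ideal.sup_pow_of_isUnit hu n
    rw [hg, Ideal.span_singleton_pow] at h1
    by_cases hg0 : g = 0
    · exact ⟨n, hn, a ^ n, by simpa [hg0] using h1⟩
    obtain ⟨m, hm, k, hk⟩ := h (a ^ n) g (pow_ne_zero n ha) hg0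
    exact ⟨n * m, mul_ne_zero hn hm, k, by rw [pow_mul, h1, ← Ideal.span_insert, hk]⟩

theorem HasPrincipalPairPowers.isMulTorsion_pic (h : HasPrincipalPairPowers A) :
    IsMulTorsion (CommRing.Pic A) := by
  refine IsMulTorsion.of_surjective (f := (ClassGroup.equivPic A).toMonoidHom)
    (ClassGroup.equivPic A).surjective fun c => ?_
  refine ClassGroup.induction (FractionRing A) (fun I => ?_) c
  -- `I` differs from the integral ideal `num` by the principal factor `den`, so a principal power
  -- of `num` gives one of `I`.
  have hI := (FractionalIdeal.isUnit_num (R := A)).2 I.isUnit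
  obtain ⟨s, hs⟩ := Ideal.fg_of_isUnit (IsFractionRing.injective A (FractionRing A)) _ hI
  obtain ⟨n, hn, g, hg⟩ := h.exists_pow_eq_span s
  rw [isOfFinOrder_iff_pow_eq_one]
  refine ⟨n, Nat.pos_of_ne_zero hn, ?_⟩
  rw [← map_pow, ClassGroup.mk_eq_one_iff]
  have hd : algebraMap A (FractionRing A) (I : FractionalIdeal A⁰ (FractionRing A)).den ≠ 0 :=
    IsFractionRing.to_map_ne_zero_of_mem_nonZeroDivisors
      (I : FractionalIdeal A⁰ (FractionRing A)).den.prop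
  have h1 := FractionalIdeal.den_mul_self_eq_num' A⁰ (FractionRing A)
    (I : FractionalIdeal A⁰ (FractionRing A))
  rw [← hs] at h1
  have h2 := congrArg (· ^ n) h1
  simp only [mul_pow, FractionalIdeal.spanSingleton_pow, ← FractionalIdeal.coeIdeal_pow] at h2
  rw [hg, FractionalIdeal.coeIdeal_span_singleton] at h2
  rw [Units.val_pow_eq_pow_val, FractionalIdeal.isPrincipal_iff]
  refine ⟨(algebraMap A (FractionRing A)
    (I : FractionalIdeal A⁰ (FractionRing A)).den ^ n)⁻¹ * algebraMap A _ g, ?_⟩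
  rw [← FractionalIdeal.spanSingleton_mul_spanSingleton, ← h2, ← mul_assoc,
    FractionalIdeal.spanSingleton_mul_spanSingleton, inv_mul_cancel₀ (pow_ne_zero n hd)]
  simp

end TwoGenerated

/-! ### Approximation for incomparable valuation rings -/

section Approximation

variable {K : Type*} [Field K]

open Finset

theorem Valuation.map_sum_range_succ_of_lt {Γ : Type*} [LinearOrderedCommGroupWithZero Γ]
    (v : Valuation K Γ) {f : ℕ → K} {n : ℕ} (h0 : v (f n) ≠ 0) (h : ∀ k < n, v (f k) < v (f n)) :
    v (∑ k ∈ range (n + 1), f k) = v (f n) := by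
  rw [sum_range_succ]
  exact v.map_add_eq_of_lt_right (v.map_sum_lt h0 fun k hk => h k (mem_range.1 hk))

/-- For `y = 1` the sum is `n + 1`, nonzero if the characteristic divides `n`. Otherwise vanishing
forces `y^(n+1) = 1`, impossible if the order of `y` divides `n`. In characteristic zero,
respectively for `orderOf y = 0`, every `n` works. -/
theorem exists_dvd_geom_sum_ne_zero {k : Type*} [Field k] (y : k) :
    ∃ d : ℕ, d ≠ 0 ∧ ∀ n, d ∣ n → ∑ i ∈ range (n + 1), y ^ i ≠ 0 := by
  by_cases hy : y = 1
  · by_cases hp : ringChar k = 0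
    · refine ⟨1, one_ne_zero, fun n _ h => ?_⟩
      simp only [hy, one_pow, sum_const, card_range, nsmul_eq_mul, mul_one] at h
      rw [ringChar.spec, hp] at h
      simp at h
    · refine ⟨ringChar k, hp, fun n hn h => ?_⟩
      simp only [hy, one_pow, sum_const, card_range, nsmul_eq_mul, mul_one] at h
      rw [ringChar.spec, Nat.dvd_add_right hn, Nat.dvd_one] at h
      exact CharP.ringChar_ne_one h
  · have key : ∀ n, ∑ i ∈ range (n + 1), y ^ i = 0 → y ^ (n + 1) = 1 := fun n h => by
      rw [← sub_eq_zero, ← geom_sum_mul, h, zero_mul]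
    by_cases ho : orderOf y = 0
    · refine ⟨1, one_ne_zero, fun n _ h => ?_⟩
      rw [orderOf_eq_zero_iff'] at ho
      exact ho _ n.succ_pos (key n h)
    · refine ⟨orderOf y, ho, fun n hn h => hy ?_⟩
      have := key n h
      rwa [pow_succ, orderOf_dvd_iff_pow_eq_one.1 hn, one_mul] at this

namespace ValuationSubring

theorem residue_eq_zero_iff_valuation_lt_one (V : ValuationSubring K) (x : V) :
    IsLocalRing.residue V x = 0 ↔ V.valuation x < 1 := by
  rw [IsLocalRing.residue_eq_zero_iff, valuation_lt_one_iff]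

theorem valuation_eq_one_of_residue_ne_zero (V : ValuationSubring K) (x : V)
    (h : IsLocalRing.residue V x ≠ 0) : V.valuation x = 1 :=
  le_antisymm (V.valuation_le_one x)
    (not_lt.1 fun h' => h ((V.residue_eq_zero_iff_valuation_lt_one x).2 h'))

/-- Where `x` is integral, a nonzero residue of the sum suffices, and a common multiple of the
finitely many divisors secures this; elsewhere the top power dominates. -/
theorem exists_valuation_geom_sum {ι : Type*} [Finite ι] (V : ι → ValuationSubring K) (x : K) :
    ∃ n : ℕ, n ≠ 0 ∧ ∀ i, (V i).valuation (∑ k ∈ range (n + 1), x ^ k) =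
      max 1 ((V i).valuation x) ^ n := by
  classical
  have := Fintype.ofFinite ι
  have key : ∀ i, ∃ d : ℕ, d ≠ 0 ∧ ∀ n, d ∣ n → x ∈ V i →
      (V i).valuation (∑ k ∈ range (n + 1), x ^ k) = 1 := fun i => by
    by_cases hx : x ∈ V i
    · obtain ⟨d, hd, h⟩ := exists_dvd_geom_sum_ne_zero (IsLocalRing.residue (V i) ⟨x, hx⟩)
      refine ⟨d, hd, fun n hn _ => ?_⟩
      have := (V i).valuation_eq_one_of_residue_ne_zero
        (∑ k ∈ range (n + 1), (⟨x, hx⟩ : V i) ^ k) (by simpa [-SubmonoidClass.mk_pow] using h n hn)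
      simpa using this
    · exact ⟨1, one_ne_zero, fun n _ h => absurd h hx⟩
  choose d hd h using key
  refine ⟨∏ i, d i, prod_ne_zero_iff.2 fun i _ => hd i, fun i => ?_⟩
  rcases le_or_gt ((V i).valuation x) 1 with hx | hx
  · rw [max_eq_left hx, one_pow]
    exact h i _ (dvd_prod_of_mem d (mem_univ i)) ((V i).mem_of_valuation_le_one x hx)
  · rw [max_eq_right hx.le, Valuation.map_sum_range_succ_of_lt, map_pow]
    · rw [map_pow]
      exact pow_ne_zero _ (zero_lt_one.trans hx).ne'
    · intro k hk
      rw [map_pow, map_pow]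
      exact pow_lt_pow_right₀ hx hk

theorem exists_valuation_lt_one_lt {V W : ValuationSubring K} (h : ¬ V ≤ W) (h' : ¬ W ≤ V) :
    ∃ u : K, V.valuation u < 1 ∧ 1 < W.valuation u := by
  obtain ⟨x, hx, hx'⟩ := SetLike.not_le_iff_exists.1 h
  obtain ⟨y, hy, hy'⟩ := SetLike.not_le_iff_exists.1 h'
  rw [← valuation_le_one_iff] at hx hx' hy hy'
  rw [not_le] at hx' hy'
  refine ⟨x / y, ?_, ?_⟩
  · rw [map_div₀, div_lt_one₀ (zero_lt_one.trans hy')]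
    exact hx.trans_lt hy'
  · rw [map_div₀, one_lt_div₀]
    · exact hy.trans_lt hx'
    · exact (Valuation.pos_iff _).2 ((Valuation.pos_iff _).1 (zero_lt_one.trans hy'))

theorem valuation_prod_sub_one_lt {ι : Type*} (V : ValuationSubring K) (s : Finset ι) (f : ι → K)
    (h : ∀ i ∈ s, V.valuation (f i - 1) < 1) : V.valuation (∏ i ∈ s, f i - 1) < 1 := by
  classical
  induction s using Finset.induction_on with
  | empty => simp
  | insert a s ha ih =>
    have h1 := ih fun i hi => h i (mem_insert_of_mem hi)
    have h2 := h a (mem_insert_self a s)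
    rw [prod_insert ha, show f a * ∏ i ∈ s, f i - 1 =
      (f a - 1) * (∏ i ∈ s, f i - 1) + ((f a - 1) + (∏ i ∈ s, f i - 1)) by ring]
    refine Valuation.map_add_lt _ ?_ (Valuation.map_add_lt _ h2 h1)
    rw [map_mul]
    exact mul_lt_one_of_nonneg_of_lt_one_left zero_le h2 h1.le

theorem exists_valuation_lt_one_and_one_lt {ι : Type*} [Finite ι] (V : ι → ValuationSubring K)
    (hV : ∀ i j, i ≠ j → ¬ V i ≤ V j) (i : ι) :
    ∃ z : K, (V i).valuation z < 1 ∧ ∀ j, j ≠ i → 1 < (V j).valuation z := by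
  classical
  have := Fintype.ofFinite ι
  have key : ∀ j, ∃ p : K, (j ≠ i → (V i).valuation (p - 1) < 1 ∧ 1 < (V j).valuation p) ∧
      ∀ k, 1 ≤ (V k).valuation p := fun j => by
    by_cases hj : j = i
    · exact ⟨1, by simp [hj]⟩
    -- The geometric sum in `u` is congruent to `1` at `V i`, large at `V j`, and of value at least
    -- `1` everywhere. The product of these sums minus `1` is therefore small at `V i` and large at
    -- all others.
    obtain ⟨u, hu, hu'⟩ := exists_valuation_lt_one_lt (hV i j (Ne.symm hj)) (hV j i hj)
    obtain ⟨n, hn, h⟩ := exists_valuation_geom_sum V u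
    refine ⟨_, fun _ => ⟨?_, ?_⟩, fun k => (h k).symm ▸ one_le_pow₀ (le_max_left _ _)⟩
    · rw [sum_range_succ', pow_zero, add_sub_cancel_right]
      refine Valuation.map_sum_lt _ one_ne_zero fun k _ => ?_
      rw [map_pow]
      exact pow_lt_one₀ zero_le hu k.succ_ne_zero
    · rw [h, max_eq_right hu'.le]
      exact one_lt_pow₀ hu' hn
  choose p hp hp' using key
  refine ⟨∏ j ∈ univ.erase i, p j - 1, valuation_prod_sub_one_lt _ _ _ fun j hj =>
    (hp j (ne_of_mem_erase hj)).1, fun j hj => ?_⟩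
  have h1 : 1 < (V j).valuation (∏ j ∈ univ.erase i, p j) := by
    rw [← mul_prod_erase _ _ (mem_erase.2 ⟨hj, mem_univ j⟩), map_mul, map_prod]
    refine one_lt_mul_of_lt_of_le (hp j hj).2 ?_
    exact prod_induction _ (1 ≤ ·) (fun _ _ h1 h2 => one_le_mul h1 h2) le_rfl fun k _ => hp' k j
  rwa [Valuation.map_sub_eq_of_lt_left]
  simpa using h1

/-- Approximation for pairwise incomparable valuation rings. -/
theorem exists_valuation_sub_lt {ι : Type*} [Finite ι] (V : ι → ValuationSubring K)
    (hV : ∀ i j, i ≠ j → ¬ V i ≤ V j) (t : ι → K)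
    (ht : ∀ i x, (V i).valuation x < 1 → (V i).valuation x ^ 2 < (V i).valuation (t i))
    (y : ι → K) (hy : ∀ i, y i ∈ V i) :
    ∃ a : K, ∀ i, (V i).valuation (a - y i) < (V i).valuation (t i) := by
  classical
  have := Fintype.ofFinite ι
  have key : ∀ i, ∃ a : K, (V i).valuation (a - y i) < (V i).valuation (t i) ∧
      ∀ j, j ≠ i → (V j).valuation a < (V j).valuation (t j) := fun i => by
    obtain ⟨z, hz, hz'⟩ := exists_valuation_lt_one_and_one_lt V hV i
    obtain ⟨n, hn, h⟩ := exists_valuation_geom_sum V (y i)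
    -- Dividing by `1 + q` changes `y i` by at most `v(z)^2` at `V i`. At `V j` the geometric sum
    -- absorbs `y i`, which need not be integral there, and leaves at most `v(z)^(-2)`. The
    -- hypothesis `ht` bounds both.
    set q := z ^ 2 * ∑ k ∈ range (n + 1), y i ^ k with hq
    have hyi := ((V i).valuation_le_one_iff (y i)).2 (hy i)
    have hqi : (V i).valuation q = (V i).valuation z ^ 2 := by
      rw [hq, map_mul, h, max_eq_left hyi, one_pow, mul_one, map_pow]
    have hqi1 : (V i).valuation q < 1 := hqi ▸ pow_lt_one₀ zero_le hz two_ne_zero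
    have h1 : (V i).valuation (1 + q) = 1 := Valuation.map_one_add_of_lt _ hqi1
    refine ⟨y i / (1 + q), ?_, fun j hj => ?_⟩
    · have h0 : 1 + q ≠ 0 := fun h0 => by simp [h0] at h1
      rw [show y i / (1 + q) - y i = - (y i * q / (1 + q)) by field_simp; ring, Valuation.map_neg,
        map_div₀, h1, div_one, map_mul, hqi]
      exact (mul_le_of_le_one_left' hyi).trans_lt (ht i z hz)
    · have hzj := hz' j hj
      have hz0 : 0 < (V j).valuation z := zero_lt_one.trans hzj
      have hqj : (V j).valuation z ^ 2 * (V j).valuation (y i) ≤ (V j).valuation q := by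
        rw [hq, map_mul, h, map_pow]
        gcongr
        exact (le_max_right _ _).trans (le_self_pow₀ (le_max_left _ _) hn)
      have hqj1 : 1 < (V j).valuation q := by
        rw [hq, map_mul, h, map_pow]
        exact one_lt_mul_of_lt_of_le (one_lt_pow₀ hzj two_ne_zero)
          (one_le_pow₀ (le_max_left _ _))
      have hinv : (V j).valuation z⁻¹ < 1 := by
        rw [map_inv₀]; exact inv_lt_one_of_one_lt₀ hzj
      refine lt_of_le_of_lt ?_ (ht j z⁻¹ hinv)
      rw [map_div₀, Valuation.map_add_eq_of_lt_right _ (by simpa using hqj1), map_inv₀, inv_pow,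
        div_le_iff₀ (zero_lt_one.trans hqj1), ← div_eq_inv_mul, le_div_iff₀ (pow_pos hz0 2), mul_comm]
      exact hqj
  choose a ha ha' using key
  refine ⟨∑ j, a j, fun i => ?_⟩
  rw [← add_sum_erase _ _ (mem_univ i), add_sub_right_comm]
  refine Valuation.map_add_lt _ (ha i) (Valuation.map_sum_lt _ ?_ fun j hj =>
    ha' j i (ne_of_mem_erase hj).symm)
  have := ht i 0 (by simp)
  exact ((zero_le).trans_lt this).ne'

end ValuationSubring

end Approximation

/-! ### Polynomials with prescribed values in tight extensions -/

section Extension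

open Finset

namespace ValuationSubring

variable {K F : Type*} [Field K] [Field F] [Algebra K F]

/-- `W` extends `V` with the same residue field, and a nonzero generator of the maximal ideal of `V`
also generates that of `W`. -/
structure IsTightExtension (V : ValuationSubring K) (W : ValuationSubring F) : Prop where
  mem_iff : ∀ b : K, algebraMap K F b ∈ W ↔ b ∈ V
  exists_lift : ∀ z ∈ W, ∃ b ∈ V, W.valuation (z - algebraMap K F b) < 1
  le_of_lt_one : ∀ t : K, t ≠ 0 → (∀ x, V.valuation x < 1 → V.valuation x ≤ V.valuation t) →
    ∀ y, W.valuation y < 1 → W.valuation y ≤ W.valuation (algebraMap K F t)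

namespace IsTightExtension

variable {V : ValuationSubring K} {W : ValuationSubring F}


theorem isEquiv (h : IsTightExtension V W) :
    (W.valuation.comap (algebraMap K F)).IsEquiv V.valuation := by
  rw [Valuation.isEquiv_iff_val_le_one]
  intro x
  rw [Valuation.comap_apply, valuation_le_one_iff, valuation_le_one_iff, h.mem_iff]

theorem le_iff (h : IsTightExtension V W) {a b : K} :
    W.valuation (algebraMap K F a) ≤ W.valuation (algebraMap K F b) ↔
    V.valuation a ≤ V.valuation b := h.isEquiv a b

theorem lt_iff (h : IsTightExtension V W) {a b : K} :
    W.valuation (algebraMap K F a) < W.valuation (algebraMap K F b) ↔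
    V.valuation a < V.valuation b := h.isEquiv.lt_iff_lt

theorem eq_iff (h : IsTightExtension V W) {a b : K} :
    W.valuation (algebraMap K F a) = W.valuation (algebraMap K F b) ↔
    V.valuation a = V.valuation b := by
  simp only [le_antisymm_iff, h.le_iff]

theorem le_one_iff (h : IsTightExtension V W) {a : K} :
    W.valuation (algebraMap K F a) ≤ 1 ↔ V.valuation a ≤ 1 := by
  simpa using h.le_iff (a := a) (b := 1)

theorem lt_one_iff (h : IsTightExtension V W) {a : K} :
    W.valuation (algebraMap K F a) < 1 ↔ V.valuation a < 1 := by
  simpa using h.lt_iff (a := a) (b := 1)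

theorem eq_one_iff (h : IsTightExtension V W) {a : K} :
    W.valuation (algebraMap K F a) = 1 ↔ V.valuation a = 1 := by
  simpa using h.eq_iff (a := a) (b := 1)

end IsTightExtension

/-- The polynomial of degree `m` with coefficients `c` has at each `z` the value `1` if `z ∈ W`
and the value of `t * z ^ m` otherwise. -/
structure IsDegreeLike (W : ValuationSubring F) (t : F) (m : ℕ) (c : ℕ → F) : Prop where
  coeff_le_one : ∀ k, W.valuation (c k) ≤ 1
  coeff_eq : W.valuation (c m) = W.valuation t
  eq_one : ∀ z, W.valuation z ≤ 1 → W.valuation (∑ k ∈ range (m + 1), c k * z ^ k) = 1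
  eq_mul_pow : ∀ z, 1 < W.valuation z →
    W.valuation (∑ k ∈ range (m + 1), c k * z ^ k) = W.valuation t * W.valuation z ^ m

/-- For all `m` divisible by `n`, every coefficient sequence that is close enough to a certain one
is degree-like in all tight extensions of `V` to `F`. -/
structure HasDegreeLike (F : Type*) [Field F] [Algebra K F] (V : ValuationSubring K) (t : K)
    (n : ℕ) : Prop where
  sq_lt : ∀ x, V.valuation x < 1 → V.valuation x ^ 2 < V.valuation t
  one_le_mul : ∀ W : ValuationSubring F, IsTightExtension V W → ∀ z, 1 < W.valuation z →
    1 ≤ W.valuation (algebraMap K F t) * W.valuation z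
  exists_coeff : ∀ m, 2 ≤ m → n ∣ m → ∃ c₀ : ℕ → K, (∀ k, c₀ k ∈ V) ∧
    ∀ c : ℕ → K, (∀ k, V.valuation (c k - c₀ k) < V.valuation t) →
      ∀ W : ValuationSubring F, IsTightExtension V W →
        IsDegreeLike W (algebraMap K F t) m (fun k => algebraMap K F (c k))

theorem residue_eq_of_valuation_sub_lt {W : ValuationSubring F} {x y : W}
    (h : W.valuation ((x : F) - y) < 1) : IsLocalRing.residue W x = IsLocalRing.residue W y := by
  rw [← sub_eq_zero, ← map_sub, residue_eq_zero_iff_valuation_lt_one]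
  exact h

/-- A lift of `f^j` works. At integral `z` its residue is a value of `f^j` on the common residue
field, hence nonzero; at other `z` the unit leading coefficient makes the top term dominate. -/
theorem hasDegreeLike_of_monic (V : ValuationSubring K)
    (f : Polynomial (IsLocalRing.ResidueField V)) (hf : f.Monic)
    (hroot : ∀ x, f.eval x ≠ 0) : HasDegreeLike F V 1 f.natDegree where
  sq_lt x hx := by
    rw [map_one]
    exact pow_lt_one₀ zero_le hx two_ne_zero
  one_le_mul W _ z hz := by simpa using hz.le
  exists_coeff := by
    rintro m - ⟨j, rfl⟩
    have hlift : ∀ k, ∃ a : V, IsLocalRing.residue V a = (f ^ j).coeff k := fun k =>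
      IsLocalRing.residue_surjective _
    choose a ha using hlift
    have hdeg : (f ^ j).natDegree = f.natDegree * j := by rw [hf.natDegree_pow, mul_comm]
    refine ⟨fun k => a k, fun k => (a k).2, fun c hc W hW => ?_⟩
    rw [map_one] at hc
    have hcV : ∀ k, V.valuation (c k) ≤ 1 := fun k => by
      rw [← sub_add_cancel (c k) (a k)]
      exact V.valuation.map_add_le (hc k).le (V.valuation_le_one _)
    have hc1 : V.valuation (c (f.natDegree * j)) = 1 := by
      have h1 : V.valuation (a (f.natDegree * j) : K) = 1 := by
        refine V.valuation_eq_one_of_residue_ne_zero _ ?_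
        rw [ha, ← hdeg, (hf.pow j).coeff_natDegree]
        exact one_ne_zero
      rw [← h1]
      exact V.valuation.map_eq_of_sub_lt (by rw [h1]; exact hc _)
    have hcW : ∀ k, W.valuation (algebraMap K F (c k)) ≤ 1 := fun k => hW.le_one_iff.2 (hcV k)
    have hcW1 : W.valuation (algebraMap K F (c (f.natDegree * j))) = 1 := hW.eq_one_iff.2 hc1
    refine ⟨hcW, by simpa using hcW1, fun z hz => ?_, fun z hz => ?_⟩
    · rw [valuation_le_one_iff] at hz
      obtain ⟨b, hb, hzb⟩ := hW.exists_lift z hz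
      have hev : V.valuation (∑ k ∈ range (f.natDegree * j + 1), (a k : K) * b ^ k) = 1 := by
        have := V.valuation_eq_one_of_residue_ne_zero
          (∑ k ∈ range (f.natDegree * j + 1), a k * (⟨b, hb⟩ : V) ^ k) (by
            have h1 : (f ^ j).eval (IsLocalRing.residue V ⟨b, hb⟩) ≠ 0 := by
              rw [Polynomial.eval_pow]
              exact pow_ne_zero _ (hroot _)
            rw [Polynomial.eval_eq_sum_range, hdeg] at h1
            simpa [-SubmonoidClass.mk_pow, ha] using h1)
        simpa using this
      let C : ℕ → W := fun k => ⟨algebraMap K F (c k), (W.valuation_le_one_iff _).1 (hcW k)⟩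
      let A : ℕ → W := fun k => ⟨algebraMap K F (a k), (hW.mem_iff _).2 (a k).2⟩
      let B : W := ⟨algebraMap K F b, (hW.mem_iff _).2 hb⟩
      have hCA : ∀ k, IsLocalRing.residue W (C k) = IsLocalRing.residue W (A k) := fun k =>
        residue_eq_of_valuation_sub_lt (by
          change W.valuation (algebraMap K F (c k) - algebraMap K F (a k)) < 1
          rw [← map_sub]
          exact hW.lt_one_iff.2 (hc k))
      have hZB : IsLocalRing.residue W ⟨z, hz⟩ = IsLocalRing.residue W B :=
        residue_eq_of_valuation_sub_lt hzb
      have hAB : IsLocalRing.residue W (∑ k ∈ range (f.natDegree * j + 1), A k * B ^ k) ≠ 0 := by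
        rw [Ne, residue_eq_zero_iff_valuation_lt_one, not_lt]
        have := hW.eq_one_iff.2 hev
        rw [← this]
        simp [A, B]
      have := W.valuation_eq_one_of_residue_ne_zero
        (∑ k ∈ range (f.natDegree * j + 1), C k * (⟨z, hz⟩ : W) ^ k) (by
          simpa [-SubmonoidClass.mk_pow, hCA, hZB] using hAB)
      simpa [C] using this
    · rw [Valuation.map_sum_range_succ_of_lt]
      · simp [hcW1]
      · rw [map_mul, hcW1, one_mul, map_pow]
        exact pow_ne_zero _ (zero_lt_one.trans hz).ne'
      · intro k hk
        rw [map_mul, map_mul, hcW1, one_mul, map_pow, map_pow]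
        exact (mul_le_of_le_one_left' (hcW k)).trans_lt (pow_lt_pow_right₀ hz hk)

/-- The model is `1 + t z^m`. Perturbations smaller than `t` keep the constant term a unit, the
leading value `v(t)`, and all other coefficients below `v(t)`. -/
theorem hasDegreeLike_of_generator (V : ValuationSubring K) (t : K) (ht0 : t ≠ 0)
    (ht1 : V.valuation t < 1) (ht : ∀ x, V.valuation x < 1 → V.valuation x ≤ V.valuation t) :
    HasDegreeLike F V t 1 := by
  have hmul : ∀ W : ValuationSubring F, IsTightExtension V W → ∀ z, 1 < W.valuation z →
      1 ≤ W.valuation (algebraMap K F t) * W.valuation z := fun W hW z hz => by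
    have h0 := zero_lt_one.trans hz
    have := hW.le_of_lt_one t ht0 ht z⁻¹ (by rw [map_inv₀]; exact inv_lt_one_of_one_lt₀ hz)
    rwa [map_inv₀, inv_le_iff_one_le_mul₀ h0] at this
  refine ⟨fun x hx => ?_, hmul, fun m hm _ => ?_⟩
  · have hpos := (Valuation.pos_iff V.valuation).2 ht0
    calc V.valuation x ^ 2 ≤ V.valuation t ^ 2 := by gcongr; exact ht x hx
      _ < V.valuation t := by
        rw [sq]
        exact mul_lt_of_lt_one_left hpos ht1
  refine ⟨fun k => if k = 0 then 1 else if k = m then t else 0, fun k => ?_, fun c hc W hW => ?_⟩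
  · rw [← valuation_le_one_iff]
    dsimp only
    split_ifs <;> simp [ht1.le]
  have hm0 : m ≠ 0 := by lia
  set T := algebraMap K F t with hT
  have hT1 : W.valuation T < 1 := hW.lt_one_iff.2 ht1
  have hT0 : W.valuation T ≠ 0 := by simpa [hT] using ht0
  have hc0 : W.valuation (algebraMap K F (c 0)) = 1 := by
    have h1 : V.valuation (c 0 - 1) < V.valuation t := by simpa using hc 0
    rw [hW.eq_one_iff, ← map_one V.valuation]
    exact V.valuation.map_eq_of_sub_lt (by rw [map_one]; exact h1.trans ht1)
  have hcm : W.valuation (algebraMap K F (c m)) = W.valuation T := by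
    have h1 : V.valuation (c m - t) < V.valuation t := by simpa [hm0] using hc m
    rw [hW.eq_iff]
    exact V.valuation.map_eq_of_sub_lt h1
  have hck : ∀ k, k ≠ 0 → W.valuation (algebraMap K F (c k)) ≤ W.valuation T := fun k hk => by
    by_cases hkm : k = m
    · rw [hkm, hcm]
    · rw [hW.le_iff]
      simpa [hk, hkm] using (hc k).le
  refine ⟨fun k => ?_, hcm, fun z hz => ?_, fun z hz => ?_⟩
  · by_cases hk : k = 0
    · rw [hk, hc0]
    · exact (hck k hk).trans hT1.le
  · rw [sum_range_succ', Valuation.map_add_eq_of_lt_right]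
    · simp [hc0]
    · rw [map_mul, hc0, pow_zero, map_one, one_mul]
      refine Valuation.map_sum_lt _ one_ne_zero fun k _ => ?_
      rw [map_mul, map_pow]
      exact (mul_le_of_le_one_right' (pow_le_one₀ zero_le hz)).trans_lt
        ((hck _ k.succ_ne_zero).trans_lt hT1)
  · have hpow : ∀ k, W.valuation z ^ k ≠ 0 := fun k => pow_ne_zero _ (zero_lt_one.trans hz).ne'
    rw [Valuation.map_sum_range_succ_of_lt]
    · rw [map_mul, hcm, map_pow]
    · rw [map_mul, hcm, map_pow]
      exact mul_ne_zero hT0 (hpow m)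
    · intro k hk
      rw [map_mul, map_mul, hcm, map_pow, map_pow]
      by_cases hk0 : k = 0
      -- Since `w(t) w(z) ≥ 1`, one has `w(t z^m) ≥ w(z)^(m-1)`, which exceeds `1` because `m ≥ 2`.
      · rw [hk0, hc0, pow_zero, mul_one, ← Nat.sub_add_cancel (show 1 ≤ m by lia), pow_succ',
          ← mul_assoc]
        exact one_lt_mul_of_le_of_lt (hmul W hW z hz) (one_lt_pow₀ hz (by lia))
      · calc _ ≤ W.valuation T * W.valuation z ^ k := by gcongr; exact hck k hk0
          _ < _ := by
            have := pow_lt_pow_right₀ hz hk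
            have := zero_lt_iff.2 hT0
            gcongr

theorem exists_hasDegreeLike (V : ValuationSubring K) (hV : V ≠ ⊤)
    (h : (IsLocalRing.maximalIdeal V).IsPrincipal ∨ ¬ IsAlgClosed (IsLocalRing.ResidueField V)) :
    ∃ (t : K) (n : ℕ), n ≠ 0 ∧ HasDegreeLike F V t n := by
  rcases h with h | h
  · obtain ⟨t, ht⟩ := h.principal
    have hle : ∀ x, V.valuation x < 1 → V.valuation x ≤ V.valuation (t : K) := fun x hx => by
      have hxV : x ∈ V := (V.valuation_le_one_iff x).1 hx.le
      have hmem : (⟨x, hxV⟩ : V) ∈ IsLocalRing.maximalIdeal V := (V.valuation_lt_one_iff _).2 hx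
      rw [ht, Ideal.submodule_span_eq, Ideal.mem_span_singleton'] at hmem
      obtain ⟨a, ha⟩ := hmem
      exact (V.valuation_le_iff _ _).2 ⟨a, congrArg Subtype.val ha⟩
    refine ⟨t, 1, one_ne_zero, hasDegreeLike_of_generator V t ?_ ?_ hle⟩
    · intro h0
      refine hV (top_le_iff.1 fun x _ => ?_)
      rw [← valuation_le_one_iff]
      by_contra hx
      rw [not_le] at hx
      have h1 := hle x⁻¹ (by rw [map_inv₀]; exact inv_lt_one_of_one_lt₀ hx)
      rw [h0, map_zero, le_zero_iff, map_inv₀, inv_eq_zero] at h1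
      simp [h1] at hx
    · rw [← valuation_lt_one_iff, ht]
      exact Submodule.mem_span_singleton_self t
  · have : ∃ f : Polynomial (IsLocalRing.ResidueField V), f.Monic ∧ Irreducible f ∧
        ∀ x, f.eval x ≠ 0 := by
      by_contra! hcon
      exact h (IsAlgClosed.of_exists_root _ hcon)
    obtain ⟨f, hf, hirr, hroot⟩ := this
    exact ⟨1, f.natDegree, hirr.natDegree_pos.ne', hasDegreeLike_of_monic V f hf hroot⟩

/-- Approximating coefficient by coefficient merges the local models. Both degrees `n` and `2n` come
with the same `t i`, so that it cancels in quotients. -/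
theorem exists_isDegreeLike {ι : Type*} [Finite ι] (V : ι → ValuationSubring K)
    (hV : ∀ i j, i ≠ j → ¬ V i ≤ V j) (htop : ∀ i, V i ≠ ⊤)
    (h : ∀ i, (IsLocalRing.maximalIdeal (V i)).IsPrincipal ∨
      ¬ IsAlgClosed (IsLocalRing.ResidueField (V i))) :
    ∃ (n : ℕ) (t : ι → F) (c d : ℕ → F), 2 ≤ n ∧
      ∀ i, ∀ W : ValuationSubring F, IsTightExtension (V i) W →
        IsDegreeLike W (t i) n c ∧ IsDegreeLike W (t i) (n + n) d ∧
          ∀ z, 1 < W.valuation z → 1 ≤ W.valuation (t i) * W.valuation z := by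
  classical
  have := Fintype.ofFinite ι
  choose t n hn hl using fun i => exists_hasDegreeLike (F := F) (V i) (htop i) (h i)
  have hprod : ∏ i, n i ≠ 0 := prod_ne_zero_iff.2 fun i _ => hn i
  have key : ∀ m, 2 ≤ m → (∏ i, n i) ∣ m → ∃ c : ℕ → F, ∀ i, ∀ W : ValuationSubring F,
      IsTightExtension (V i) W → IsDegreeLike W (algebraMap K F (t i)) m c := fun m hm hdvd => by
    choose c₀ hc₀ hc using fun i =>
      (hl i).exists_coeff m hm ((dvd_prod_of_mem n (mem_univ i)).trans hdvd)
    choose c hc' using fun k => exists_valuation_sub_lt V hV t (fun i => (hl i).sq_lt)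
      (fun i => c₀ i k) (fun i => hc₀ i k)
    exact ⟨fun k => algebraMap K F (c k), fun i W hW => hc i c (fun k => hc' k i) W hW⟩
  obtain ⟨c, hc⟩ := key ((∏ i, n i) * 2) (by lia) (dvd_mul_right _ _)
  obtain ⟨d, hd⟩ := key ((∏ i, n i) * 2 + (∏ i, n i) * 2) (by lia)
    (dvd_add (dvd_mul_right _ _) (dvd_mul_right _ _))
  exact ⟨(∏ i, n i) * 2, fun i => algebraMap K F (t i), c, d, by lia, fun i W hW =>
    ⟨hc i W hW, hd i W hW, (hl i).one_le_mul W hW⟩⟩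

end ValuationSubring

end Extension

/-! ### Principal powers in intersections of valuation rings -/

section PairPowers

open Finset

theorem Ideal.span_pair_pow_eq_span_singleton {A : Type*} [CommRing A] {a b g : A} {n : ℕ}
    (α : ℕ → A) (hg : g = ∑ k ∈ range (n + 1), α k * (b ^ k * a ^ (n - k)))
    (hdvd : ∀ k ≤ n, g ∣ b ^ k * a ^ (n - k)) :
    Ideal.span {a, b} ^ n = Ideal.span {g} := by
  have ha : a ∈ Ideal.span {a, b} := Ideal.subset_span (by simp)
  have hb : b ∈ Ideal.span {a, b} := Ideal.subset_span (by simp)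
  apply le_antisymm
  · rw [Ideal.span_insert, sup_comm, ← Ideal.add_eq_sup, add_pow, Ideal.sum_eq_sup,
      Finset.sup_le_iff]
    intro k hk
    refine Ideal.mul_le_left.trans ?_
    rw [Ideal.span_singleton_pow, Ideal.span_singleton_pow, Ideal.span_singleton_mul_span_singleton,
      Ideal.span_singleton_le_span_singleton]
    exact hdvd k (Nat.lt_succ_iff.1 (mem_range.1 hk))
  · rw [Ideal.span_singleton_le_iff_mem, hg]
    refine Ideal.sum_mem _ fun k hk => Ideal.mul_mem_left _ _ ?_
    have := Ideal.mul_mem_mul (Ideal.pow_mem_pow hb k) (Ideal.pow_mem_pow ha (n - k))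
    rwa [← pow_add, Nat.add_sub_cancel' (Nat.lt_succ_iff.1 (mem_range.1 hk))] at this

namespace ValuationSubring

/-- The generator is `a^n P / Q`. Its value `w(a)^n max(1, w(z))^n` makes it divide every `b^k
a^(n-k)`; it lies in `(a, b)^n` because `P / Q` is a polynomial in `z` of degree `n` with
coefficients in `A`. -/
theorem hasPrincipalPairPowers {F σ : Type*} [Field F] [Nonempty σ] (W : σ → ValuationSubring F)
    (A : Subring F) (hA : ∀ z, z ∈ A ↔ ∀ s, z ∈ W s) (t : σ → F) (n : ℕ) (hn : 2 ≤ n)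
    (c d : ℕ → F) (hc : ∀ s, IsDegreeLike (W s) (t s) n c)
    (hd : ∀ s, IsDegreeLike (W s) (t s) (n + n) d)
    (ht : ∀ s z, 1 < (W s).valuation z → 1 ≤ (W s).valuation (t s) * (W s).valuation z) :
    HasPrincipalPairPowers A := by
  intro a b ha _
  have ha0 : (a : F) ≠ 0 := by simpa using ha
  simp only [← valuation_le_one_iff] at hA
  set z : F := b / a with hz
  set Q := ∑ k ∈ range (n + 1), c k * z ^ k with hQ
  set P := ∑ k ∈ range (n + n + 1), d k * z ^ k with hP
  have hQpow : ∀ s, ∀ k < n, (W s).valuation z ^ k ≤ (W s).valuation Q := fun s k hk => by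
    rcases le_or_gt ((W s).valuation z) 1 with h | h
    · rw [(hc s).eq_one z h]
      exact pow_le_one₀ zero_le h
    · rw [(hc s).eq_mul_pow z h, ← Nat.sub_add_cancel (show 1 ≤ n by lia), pow_succ', ← mul_assoc]
      exact (pow_le_pow_right₀ h.le (by lia)).trans (le_mul_of_one_le_left' (ht s z h))
  have hQpos : ∀ s, 0 < (W s).valuation Q := fun s =>
    zero_lt_one.trans_le (by simpa using hQpow s 0 (by lia))
  have htop : ∀ s, (W s).valuation (d (n + n) * z ^ n) ≤ (W s).valuation Q := fun s => by
    rcases le_or_gt ((W s).valuation z) 1 with h | h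
    · rw [(hc s).eq_one z h, map_mul, map_pow]
      exact mul_le_one₀ ((hd s).coeff_le_one _) zero_le (pow_le_one₀ zero_le h)
    · rw [(hc s).eq_mul_pow z h, map_mul, map_pow, (hd s).coeff_eq]
  have hPQ : ∀ s, (W s).valuation (P / Q) = max 1 ((W s).valuation z) ^ n := fun s => by
    rw [map_div₀, div_eq_iff (hQpos s).ne']
    rcases le_or_gt ((W s).valuation z) 1 with h | h
    · rw [(hc s).eq_one z h, (hd s).eq_one z h, max_eq_left h, one_pow, mul_one]
    · rw [(hc s).eq_mul_pow z h, (hd s).eq_mul_pow z h, max_eq_right h.le, pow_add, mul_left_comm]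
  have hPQpos : ∀ s, 0 < (W s).valuation (P / Q) := fun s => by
    rw [hPQ]
    exact pow_pos (zero_lt_one.trans_le (le_max_left _ _)) n
  have hPQ0 : P / Q ≠ 0 := ((W (Classical.arbitrary σ)).valuation.pos_iff).1 (hPQpos _)
  have hterm : ∀ k, k ≤ n → ((b : F) ^ k * a ^ (n - k)) = a ^ n * z ^ k := fun k hk => by
    rw [hz, div_pow, ← Nat.sub_add_cancel hk, pow_add, Nat.add_sub_cancel]
    field_simp
  -- The terms of `P` of degree at least `n` are gathered into the coefficient of `z^n`. The
  -- coefficients are integral since `Q` dominates `z^k` for `k < n` and also `d (n + n) * z^n`,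
  -- whose factor `d (n + n)` has the value of `t`.
  have hα : ∀ k, ∃ α : A, (α : F) = if k < n then d k / Q else
      (∑ l ∈ range (n + 1), d (n + l) * z ^ l) / Q := fun k => by
    suffices hmem : (if k < n then d k / Q else
        (∑ l ∈ range (n + 1), d (n + l) * z ^ l) / Q) ∈ A from ⟨⟨_, hmem⟩, rfl⟩
    rw [hA]
    intro s
    by_cases hk : k < n
    · rw [if_pos hk, map_div₀, div_le_one₀ (hQpos s)]
      exact ((hd s).coeff_le_one k).trans (by simpa using hQpow s 0 (by lia))
    · rw [if_neg hk, map_div₀, div_le_one₀ (hQpos s), sum_range_succ]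
      refine Valuation.map_add_le _ (Valuation.map_sum_le _ fun l hl => ?_) (htop s)
      rw [map_mul, map_pow]
      exact (mul_le_of_le_one_left' ((hd s).coeff_le_one _)).trans (hQpow s l (mem_range.1 hl))
  choose α hα using hα
  have hPsum : (P / Q) = ∑ k ∈ range (n + 1), (α k : F) * z ^ k := by
    rw [sum_range_succ, hα, if_neg (lt_irrefl n), hP, add_assoc, sum_range_add, add_div, sum_div,
      div_mul_eq_mul_div, sum_mul]
    congr 1
    · refine sum_congr rfl fun k hk => ?_
      rw [hα, if_pos (mem_range.1 hk), div_mul_eq_mul_div]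
    · congr 1
      refine sum_congr rfl fun k _ => by ring
  have hsum : ∑ k ∈ range (n + 1), (α k : F) * ((b : F) ^ k * a ^ (n - k)) = a ^ n * (P / Q) := by
    rw [hPsum, mul_sum]
    refine sum_congr rfl fun k hk => ?_
    rw [hterm k (Nat.lt_succ_iff.1 (mem_range.1 hk))]
    ring
  refine ⟨n, by lia, _, Ideal.span_pair_pow_eq_span_singleton α rfl fun k hk => ?_⟩
  refine ⟨⟨z ^ k / (P / Q), (hA _).2 fun s => ?_⟩, Subtype.ext ?_⟩
  · rw [map_div₀, div_le_one₀ (hPQpos s), hPQ, map_pow]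
    exact (pow_le_pow_left₀ zero_le (le_max_right _ _) k).trans
      (pow_le_pow_right₀ (le_max_left _ _) hk)
  · simp only [Subring.coe_mul, AddSubmonoidClass.coe_finsetSum, SubmonoidClass.coe_pow]
    rw [hsum, hterm k hk]
    rw [mul_assoc, mul_div_cancel₀ _ hPQ0]

end ValuationSubring

end PairPowers

/-! ### Valuation rings of `K(x)` attached to points -/

section PointValuation

variable {K : Type*} [Field K]

namespace RatFunc

theorem eval_inv_of_ne_zero {φ : RatFunc K} {a : K} (h : φ.eval (RingHom.id K) a ≠ 0) :
    φ⁻¹.denom.eval a ≠ 0 ∧ φ⁻¹.eval (RingHom.id K) a = (φ.eval (RingHom.id K) a)⁻¹ := by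
  have hφ : φ ≠ 0 := by rintro rfl; simp at h
  have hd : φ.denom.eval a ≠ 0 := eval₂_denom_ne_zero h
  have hn : φ.num.eval a ≠ 0 := fun h0 => h (by
    rw [RatFunc.eval]; change φ.num.eval a / _ = 0; rw [h0, zero_div])
  have hd' : φ⁻¹.denom.eval a ≠ 0 := fun h0 =>
    hn (Polynomial.eval_eq_zero_of_dvd_of_eval_eq_zero (associated_denom_inv hφ).dvd h0)
  refine ⟨hd', eq_inv_of_mul_eq_one_right ?_⟩
  rw [← eval_mul _ _ hd hd', mul_inv_cancel₀ hφ, eval_one]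

theorem eval_inv_of_eval_denom_eq_zero {φ : RatFunc K} {a : K} (h : φ.denom.eval a = 0) :
    φ⁻¹.denom.eval a ≠ 0 ∧ φ⁻¹.eval (RingHom.id K) a = 0 := by
  have hφ : φ ≠ 0 := by rintro rfl; simp at h
  have hn : φ.num.eval a ≠ 0 := by
    obtain ⟨u, v, huv⟩ := φ.isCoprime_num_denom
    intro h0
    have := congrArg (Polynomial.eval a) huv
    simp [h, h0] at this
  refine ⟨fun h0 =>
    hn (Polynomial.eval_eq_zero_of_dvd_of_eval_eq_zero (associated_denom_inv hφ).dvd h0), ?_⟩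
  have h1 : φ⁻¹.num.eval a = 0 :=
    Polynomial.eval_eq_zero_of_dvd_of_eval_eq_zero (associated_num_inv hφ).symm.dvd h
  rw [RatFunc.eval]
  change φ⁻¹.num.eval a / _ = 0
  rw [h1, zero_div]

end RatFunc

namespace ValuationSubring

/-- The rational functions without pole at `a` and with value in `V` at `a`. -/
noncomputable def atPoint (V : ValuationSubring K) (a : K) : ValuationSubring (RatFunc K) where
  __ := intValuedRatFunc {a} V.toSubring
  mem_or_inv_mem' φ := by
    change (∀ b ∈ ({a} : Set K), φ.denom.eval b ≠ 0 ∧ φ.eval (RingHom.id K) b ∈ V) ∨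
      (∀ b ∈ ({a} : Set K), φ⁻¹.denom.eval b ≠ 0 ∧ φ⁻¹.eval (RingHom.id K) b ∈ V)
    simp only [Set.mem_singleton_iff, forall_eq]
    by_cases hd : φ.denom.eval a = 0
    · obtain ⟨h1, h2⟩ := RatFunc.eval_inv_of_eval_denom_eq_zero hd
      exact Or.inr ⟨h1, h2 ▸ V.zero_mem⟩
    by_cases he : φ.eval (RingHom.id K) a = 0
    · exact Or.inl ⟨hd, he ▸ V.zero_mem⟩
    obtain ⟨h1, h2⟩ := RatFunc.eval_inv_of_ne_zero he
    exact (V.mem_or_inv_mem (φ.eval (RingHom.id K) a)).imp (⟨hd, ·⟩) fun h => ⟨h1, h2 ▸ h⟩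

theorem mem_atPoint {V : ValuationSubring K} {a : K} {φ : RatFunc K} :
    φ ∈ V.atPoint a ↔ φ.denom.eval a ≠ 0 ∧ φ.eval (RingHom.id K) a ∈ V := by
  change (∀ b ∈ ({a} : Set K), φ.denom.eval b ≠ 0 ∧ φ.eval (RingHom.id K) b ∈ V) ↔ _
  simp

theorem atPoint_valuation_lt_one_iff {V : ValuationSubring K} {a : K} {φ : RatFunc K} :
    (V.atPoint a).valuation φ < 1 ↔
      φ.denom.eval a ≠ 0 ∧ V.valuation (φ.eval (RingHom.id K) a) < 1 := by
  by_cases hd : φ.denom.eval a = 0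
  · simp only [hd, ne_eq, not_true_eq_false, false_and, iff_false]
    intro h
    exact (mem_atPoint.1 (((V.atPoint a).valuation_le_one_iff φ).1 h.le)).1 hd
  by_cases he : φ.eval (RingHom.id K) a = 0
  · simp only [hd, he, ne_eq, not_false_eq_true, map_zero, zero_lt_one, and_self, iff_true]
    rw [← mem_nonunits_iff, mem_nonunits_iff_or, or_iff_not_imp_left]
    intro h0 hmem
    have h1 := (mem_atPoint.1 hmem).1
    have h2 := RatFunc.eval_mul (RingHom.id K) a hd h1
    rw [mul_inv_cancel₀ h0, he, RatFunc.eval_one, zero_mul] at h2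
    exact one_ne_zero h2
  · have h0 : φ ≠ 0 := by rintro rfl; simp at he
    obtain ⟨h1, h2⟩ := RatFunc.eval_inv_of_ne_zero he
    rw [← mem_nonunits_iff, mem_nonunits_iff_or, ← mem_nonunits_iff, mem_nonunits_iff_or,
      mem_atPoint, h2]
    simp [h0, he, hd, h1]

/-- Evaluation at `a` identifies the residue fields: `φ` is congruent to the constant `φ(a)`. If
`φ(a)` is divisible by `t` in `V`, then `φ / t` still lies in `V.atPoint a`. -/
theorem isTightExtension_atPoint (V : ValuationSubring K) (a : K) :
    IsTightExtension V (V.atPoint a) where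
  mem_iff b := by
    rw [mem_atPoint, RatFunc.algebraMap_eq_C, RatFunc.eval_C, RatFunc.denom_C]
    simp
  exists_lift φ hφ := by
    obtain ⟨h1, h2⟩ := mem_atPoint.1 hφ
    refine ⟨_, h2, ?_⟩
    set b := φ.eval (RingHom.id K) a with hb
    rw [RatFunc.algebraMap_eq_C, sub_eq_add_neg, ← map_neg, atPoint_valuation_lt_one_iff]
    have hC : (RatFunc.C (-b)).denom.eval a ≠ 0 := by rw [RatFunc.denom_C]; simp
    constructor
    · intro h
      have := Polynomial.eval_eq_zero_of_dvd_of_eval_eq_zero (RatFunc.denom_add_dvd _ _) h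
      rw [Polynomial.eval_mul] at this
      exact mul_ne_zero h1 hC this
    · rw [RatFunc.eval_add _ _ h1 hC, RatFunc.eval_C, ← hb]
      simp
  le_of_lt_one t ht0 ht φ hφ := by
    obtain ⟨h1, h2⟩ := atPoint_valuation_lt_one_iff.1 hφ
    have hC : (RatFunc.C t⁻¹).denom.eval a ≠ 0 := by rw [RatFunc.denom_C]; simp
    have hmem : φ * RatFunc.C t⁻¹ ∈ V.atPoint a := by
      refine mem_atPoint.2 ⟨fun h => ?_, ?_⟩
      · have := Polynomial.eval_eq_zero_of_dvd_of_eval_eq_zero (RatFunc.denom_mul_dvd _ _) h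
        rw [Polynomial.eval_mul] at this
        exact mul_ne_zero h1 hC this
      · rw [RatFunc.eval_mul _ _ h1 hC, RatFunc.eval_C, ← valuation_le_one_iff, map_mul,
          RingHom.id_apply, map_inv₀, ← div_eq_mul_inv, div_le_one₀ ((Valuation.pos_iff _).2 ht0)]
        exact ht _ h2
    refine (valuation_le_iff _ _ _).2 ⟨⟨_, hmem⟩, ?_⟩
    rw [RatFunc.algebraMap_eq_C]
    change φ * RatFunc.C t⁻¹ * RatFunc.C t = φ
    rw [mul_assoc, ← map_mul, inv_mul_cancel₀ ht0, map_one, mul_one]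

end ValuationSubring

theorem mem_intValuedRatFunc {E : Set K} {D : Subring K} {φ : RatFunc K} :
    φ ∈ intValuedRatFunc E D ↔ ∀ a ∈ E, φ.denom.eval a ≠ 0 ∧ φ.eval (RingHom.id K) a ∈ D :=
  Iff.rfl

theorem algebraMap_mem_intValuedRatFunc {E : Set K} {D : Subring K} (p : Polynomial K)
    (h : ∀ a ∈ E, p.eval a ∈ D) : algebraMap (Polynomial K) (RatFunc K) p ∈ intValuedRatFunc E D :=
  fun a ha => by simpa [RatFunc.eval] using h a ha

/-- If `D = K` at all points of `E`, then two-generated ideals are principal. -/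
theorem hasPrincipalPairPowers_intValuedRatFunc_of_forall_mem {E : Set K} {D : Subring K}
    (hD : ∀ a ∈ E, ∀ x : K, x ∈ D) : HasPrincipalPairPowers (intValuedRatFunc E D) := by
  have hpol : ∀ p : Polynomial K, algebraMap (Polynomial K) (RatFunc K) p ∈ intValuedRatFunc E D :=
    fun p => algebraMap_mem_intValuedRatFunc p fun a ha => hD a ha _
  let f : Polynomial K →+* intValuedRatFunc E D :=
    (algebraMap (Polynomial K) (RatFunc K)).codRestrict _ hpol
  have hden : ∀ φ ∈ intValuedRatFunc E D,
      (algebraMap (Polynomial K) (RatFunc K) φ.denom)⁻¹ ∈ intValuedRatFunc E D := fun φ hφ a ha => by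
    have h1 : (algebraMap (Polynomial K) (RatFunc K) φ.denom).eval (RingHom.id K) a ≠ 0 := by
      simpa [RatFunc.eval] using (hφ a ha).1
    exact ⟨(RatFunc.eval_inv_of_ne_zero h1).1, hD a ha _⟩
  -- Denominators of elements are units here, so every principal ideal is extended from `K[x]`,
  -- where ideals are principal.
  have hspan : ∀ φ : intValuedRatFunc E D,
      Ideal.span {φ} = (Ideal.span {(φ : RatFunc K).num}).map f := fun φ => by
    have h0 : algebraMap (Polynomial K) (RatFunc K) (φ : RatFunc K).denom ≠ 0 :=
      RatFunc.algebraMap_ne_zero (RatFunc.denom_ne_zero _)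
    have hnd := RatFunc.num_div_denom (φ : RatFunc K)
    rw [Ideal.map_span, Set.image_singleton]
    apply le_antisymm
    · rw [Ideal.span_singleton_le_span_singleton]
      refine ⟨⟨_, hden φ φ.2⟩, Subtype.ext ?_⟩
      change (φ : RatFunc K) = algebraMap (Polynomial K) (RatFunc K) _ * _
      rw [← div_eq_mul_inv, hnd]
    · rw [Ideal.span_singleton_le_span_singleton]
      refine ⟨f (φ : RatFunc K).denom, Subtype.ext ?_⟩
      change algebraMap (Polynomial K) (RatFunc K) _ = (φ : RatFunc K) * algebraMap _ _ _
      rw [← div_eq_iff h0, hnd]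
  intro φ ψ _ _
  obtain ⟨d, hd⟩ := (IsPrincipalIdealRing.principal
    (Ideal.span {(φ : RatFunc K).num} ⊔ Ideal.span {(ψ : RatFunc K).num})).principal
  refine ⟨1, one_ne_zero, f d, ?_⟩
  rw [pow_one, Ideal.span_insert, hspan φ, hspan ψ, ← Ideal.map_sup, hd, Ideal.submodule_span_eq,
    Ideal.map_span, Set.image_singleton]

theorem hasPrincipalPairPowers_intValuedRatFunc {ι : Type*} [Finite ι]
    (V : ι → ValuationSubring K) (hV : ∀ i j, i ≠ j → (V i).Independent (V j))
    (h : ∀ i, (IsLocalRing.maximalIdeal (V i)).IsPrincipal ∨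
      ¬ IsAlgClosed (IsLocalRing.ResidueField (V i))) (E : Set K) :
    HasPrincipalPairPowers (intValuedRatFunc E (⨅ i, (V i).toSubring)) := by
  -- A ring `V i = K` only forbids poles, as any other `V i` already does, so it can be dropped when
  -- a nontrivial one remains. If none remains or `E` is empty, the condition on values is void.
  by_cases hcase : E.Nonempty ∧ ∃ i, V i ≠ ⊤
  · obtain ⟨⟨a₀, ha₀⟩, i₀, hi₀⟩ := hcase
    let ι' := {i // V i ≠ ⊤}
    -- If `V i ≤ V j`, then `V j` contains both rings, so independence forces `V j = K`.
    have hinc : ∀ i j : ι', i ≠ j → ¬ V i ≤ V j := fun i j hij hle =>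
      j.2 (hV i j (fun h => hij (Subtype.ext h)) _ hle le_rfl)
    obtain ⟨n, t, c, d, hn, hW⟩ := ValuationSubring.exists_isDegreeLike (F := RatFunc K)
      (fun i : ι' => V i) hinc (fun i => i.2) (fun i => h i)
    have : Nonempty (ι' × E) := ⟨⟨⟨i₀, hi₀⟩, ⟨a₀, ha₀⟩⟩⟩
    have hT := fun s : ι' × E => hW s.1 _ ((V s.1).isTightExtension_atPoint s.2)
    refine ValuationSubring.hasPrincipalPairPowers (fun s : ι' × E => (V s.1).atPoint s.2) _
      (fun φ => ?_) (fun s => t s.1) n hn c d (fun s => (hT s).1) (fun s => (hT s).2.1)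
      (fun s => (hT s).2.2)
    simp only [mem_intValuedRatFunc, ValuationSubring.mem_atPoint, Subring.mem_iInf,
      ValuationSubring.mem_toSubring]
    constructor
    · exact fun hφ s => ⟨(hφ _ s.2.2).1, (hφ _ s.2.2).2 _⟩
    · refine fun hφ a ha => ⟨(hφ (⟨i₀, hi₀⟩, ⟨a, ha⟩)).1, fun i => ?_⟩
      by_cases hi : V i = ⊤
      · rw [hi]; exact ValuationSubring.mem_top _
      · exact (hφ (⟨i, hi⟩, ⟨a, ha⟩)).2
  · refine hasPrincipalPairPowers_intValuedRatFunc_of_forall_mem fun a ha x => ?_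
    push Not at hcase
    simp only [Subring.mem_iInf, ValuationSubring.mem_toSubring]
    intro i
    rw [hcase ⟨a, ha⟩ i]
    exact ValuationSubring.mem_top _

end PointValuation

theorem mainTheorem10 {K : Type*} [Field K] (r : ℕ) (V : Fin r → ValuationSubring K)
    (hV : ∀ i j : Fin r, i ≠ j → (V i).Independent (V j))
    (h : ∀ i : Fin r, (IsLocalRing.maximalIdeal (V i)).IsPrincipal ∨
      ¬ IsAlgClosed (IsLocalRing.ResidueField (V i)))
    (E : Set K) :
    IsPruferDomain (intValuedRatFunc E (⨅ i : Fin r, (V i).toSubring)) ∧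
      IsMulTorsion (CommRing.Pic (intValuedRatFunc E (⨅ i : Fin r, (V i).toSubring))) := by
  have hP := hasPrincipalPairPowers_intValuedRatFunc V hV h E
  exact ⟨hP.isPruferDomain, hP.isMulTorsion_pic⟩
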